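/- Let $F$ be a field of characteristic $2$. For $\alpha\in F$ and $\beta\in F^\times$ let $[\alpha,\beta)=F[x,y : x^2+x=\alpha,\ y^2=\beta,\ xy+yx=y]$ be the corresponding quaternion algebra. Let $A$ be a biquaternion division algebra over $F$, i.e. a division algebra that is isomorphic over $F$ to $[\alpha,\beta)\otimes_F[\gamma,\delta)$ for some $\alpha,\gamma\in F$, $\beta,\delta\in F^\times$. A quadruple of generators of $A$ is a quadruple $(x,y,z,u)$ of elements that generate $A$ as an $F$-algebra and satisfy $x^2+x\in F$, $y^2\in F$, $z^2+z\in F$, $u^2\in F$, $xy+yx=y$, $zu+uz=u$, and such that $x$ and $y$ both commute with $z$ and $u$. It consists of the two pairs $(x,y)$ and $(z,u)$, whose order is disregarded: $(x,y,z,u)=(z,u,x,y)$. A step from one quadruple of generators of $A$ to another is - of type $\Lambda_3$ if at most three generators are changed (at least one generator is preserved); - of type $\Lambda_2$ if at most one generator is changed in each pair; - of type $\Pi$ if at most one pair is changed. Theorem. Every step of type $\Lambda_3$ can be achieved by a chain of steps consisting of at most three steps of type $\Pi$ and at most two steps of type $\Lambda_2$. That is, if a step of type $\Lambda_3$ leads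 from one quadruple of generators of $A$ to another, then the second can be reached from the first through quadruples of generators of $A$ by such a chain, the steps being taken in some order. -/

import Mathlib

open scoped Quaternion TensorProduct

/-- `A` is a biquaternion algebra over `F` (a field of characteristic two), that is,
`A ≅ [α, β) ⊗ [γ, δ)` as `F`-algebras. In characteristic two the quaternion algebra
`[α, β) = F[x, y : x² + x = α, y² = β, x y + y x = y]` is Mathlib's `ℍ[F, α, 1, β]`, whose basis
`1, i, j, i j` satisfies `i² = α + i`, `j² = β`, `j i = j - i j`. -/
def IsBiquaternionAlgebra (F A : Type*) [Field F] [Ring A] [Algebra F A] : Prop :=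
  ∃ α β γ δ : F, β ≠ 0 ∧ δ ≠ 0 ∧ Nonempty (A ≃ₐ[F] ℍ[F, α, 1, β] ⊗[F] ℍ[F, γ, 1, δ])

/-- A quadruple of generators `(x, y, z, u)` of the `F`-algebra `A`. Since the four elements
generate `A`, for a biquaternion algebra `A` the relations say that `A = F[x, y] ⊗ F[z, u]` with
`F[x, y] = [α, β)` and `F[z, u] = [γ, δ)`. -/
@[ext]
structure GenQuadruple (F A : Type*) [Field F] [Ring A] [Algebra F A] where
  x : A
  y : A
  z : A
  u : A
  x_artinSchreier : ∃ α : F, x ^ 2 + x = algebraMap F A α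
  y_squareCentral : ∃ β : F, y ^ 2 = algebraMap F A β
  z_artinSchreier : ∃ γ : F, z ^ 2 + z = algebraMap F A γ
  u_squareCentral : ∃ δ : F, u ^ 2 = algebraMap F A δ
  xy_rel : x * y + y * x = y
  xz_comm : x * z = z * x
  xu_comm : x * u = u * x
  yz_comm : y * z = z * y
  yu_comm : y * u = u * y
  zu_rel : z * u + u * z = u
  generate : Algebra.adjoin F ({x, y, z, u} : Set A) = ⊤

namespace GenQuadruple

variable {F A : Type*} [Field F] [Ring A] [Algebra F A]

/-- The quadruple `(z, u, x, y)`. -/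
def swap (q : GenQuadruple F A) : GenQuadruple F A where
  x := q.z
  y := q.u
  z := q.x
  u := q.y
  x_artinSchreier := q.z_artinSchreier
  y_squareCentral := q.u_squareCentral
  z_artinSchreier := q.x_artinSchreier
  u_squareCentral := q.y_squareCentral
  xy_rel := q.zu_rel
  xz_comm := q.xz_comm.symm
  xu_comm := q.yz_comm.symm
  yz_comm := q.xu_comm.symm
  yu_comm := q.yu_comm.symm
  zu_rel := q.xy_rel
  generate := by
    have h : ({q.z, q.u, q.x, q.y} : Set A) = {q.x, q.y, q.z, q.u} := by
      ext a
      simp only [Set.mem_insert_iff, Set.mem_singleton_iff]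
      tauto
    rw [h]
    exact q.generate

/-- Equality of quadruples when the order of the two pairs is disregarded:
`(x, y, z, u) = (z, u, x, y)`. -/
def Same (q r : GenQuadruple F A) : Prop := r = q ∨ r = q.swap

/-- Step of type `Λ₃`: at most three generators are changed, i.e. at least one is preserved
(the order of the pairs being disregarded). -/
def StepLambda3 (q r : GenQuadruple F A) : Prop :=
  ∃ s : GenQuadruple F A, r.Same s ∧ (q.x = s.x ∨ q.y = s.y ∨ q.z = s.z ∨ q.u = s.u)

/-- Step of type `Λ₂`: at most one generator is changed in each pair
(the order of the pairs being disregarded). -/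
def StepLambda2 (q r : GenQuadruple F A) : Prop :=
  ∃ s : GenQuadruple F A, r.Same s ∧ (q.x = s.x ∨ q.y = s.y) ∧ (q.z = s.z ∨ q.u = s.u)

/-- Step of type `Π`: at most one pair is changed (the order of the pairs being disregarded). -/
def StepPi (q r : GenQuadruple F A) : Prop :=
  ∃ s : GenQuadruple F A, r.Same s ∧ ((q.x = s.x ∧ q.y = s.y) ∨ (q.z = s.z ∧ q.u = s.u))

/-- `Chain m n q r`: there is a chain of quadruples of generators leading from `q` to `r` that
consists of exactly `m` steps of type `Π` and `n` steps of type `Λ₂`, in some order. -/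
inductive Chain : ℕ → ℕ → GenQuadruple F A → GenQuadruple F A → Prop
  | nil {q r : GenQuadruple F A} : q.Same r → Chain 0 0 q r
  | consPi {m n : ℕ} {q r s : GenQuadruple F A} :
      q.StepPi r → Chain m n r s → Chain (m + 1) n q s
  | consLambda2 {m n : ℕ} {q r s : GenQuadruple F A} :
      q.StepLambda2 r → Chain m n r s → Chain m (n + 1) q s

end GenQuadruple

/-!
Write `C(x, y)` for the centralizer of a pair `x, y` of a quadruple; it is the quaternion algebra
generated by the other pair. Suppose that the quadruples `(x, y, z, u)` and `(x', y', z', u')`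
share the generator `x = x'` or `y = y'` (up to swapping the pairs, there is no other case). The
point is that `C(x, y) ∩ C(x', y')` is larger than `F`.

* If `x = x'`, then `y * y' + y' * y` commutes with `x`, `y`, `y'`. If it is a scalar `l`, then
  `y' * y + l * x` commutes with them too, and if that is also a scalar, then `y'` lies in
  `F[x, y]`, so that `z` is a common element
  (`exists_commute_of_common_artinSchreier`).
* If `y = y'`, the same holds with `x + x' + (x * x' + x' * x)` and `y * (x * x' + x' * x)`
  (`exists_commute_of_common_squareCentral`).

Let `w` be a common element outside `F`. It satisfies a quadratic equation `w² + k w ∈ F`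
(`GenQuadruple.exists_sq_add_mul_eq`). If `k ≠ 0`, then after scaling `w² + w ∈ F`, and `w` is the
first member of a pair generating `C(x, y)` as well as of one generating `C(x', y')`; if `k = 0`,
it is the second member of such pairs (`GenQuadruple.exists_replace_z`,
`GenQuadruple.exists_replace_u`). Replacing `(z, u)` by the pair of `C(x, y)` is a step of type
`Π`; the passage to `x', y'` together with the pair of `C(x', y')` is a step of type `Λ₂`, because
`w` is kept; a second step of type `Π` restores `(z', u')`. Thus two steps of type `Π` and one of
type `Λ₂` always suffice.

The structural input is that a biquaternion algebra is central of dimension 16; the dimension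
only serves to exclude quadruples with `y = 0` or `u = 0`.
-/

/-! ### Centre and dimension of a biquaternion algebra -/

theorem QuaternionAlgebra.isCentral_of_charTwo {F : Type*} [Field F] [CharP F 2] (α β : F) :
    Algebra.IsCentral F ℍ[F, α, 1, β] where
  out w hw := by
    rw [Subalgebra.mem_center_iff] at hw
    have hi := congrArg imK (hw ⟨0, 1, 0, 0⟩)
    have hij := congrArg imJ (hw ⟨0, 1, 0, 0⟩)
    have hj := congrArg imJ (hw ⟨0, 0, 1, 0⟩)
    have h2 : (2 : F) = 0 := CharTwo.two_eq_zero
    simp only [QuaternionAlgebra.imJ_mul, QuaternionAlgebra.imK_mul] at hi hij hj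
    have hK : w.imK = 0 := by linear_combination hi - w.imJ * h2
    have hJ : w.imJ = 0 := by linear_combination -hij + α * w.imK * h2
    have hI : w.imI = 0 := by linear_combination hj
    refine Algebra.mem_bot.2 ⟨w.re, ?_⟩
    ext <;> simp [hI, hJ, hK]

theorem Algebra.IsCentral.tensorProduct {F B C : Type*} [Field F] [Ring B] [Ring C] [Nontrivial B]
    [Algebra F B] [Algebra F C] [Algebra.IsCentral F B] [Algebra.IsCentral F C] :
    Algebra.IsCentral F (B ⊗[F] C) where
  out w hw := by
    -- Commuting with `B ⊗ 1` puts `w` into `1 ⊗ C`, where it has to be central.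
    have hw' : w ∈ Subalgebra.centralizer F
        ((Algebra.TensorProduct.includeLeft : B →ₐ[F] B ⊗[F] C).range : Set (B ⊗[F] C)) :=
      fun v _ => Subalgebra.mem_center_iff.1 hw v
    rw [Subalgebra.centralizer_coe_range_includeLeft_eq_center_tensorProduct] at hw'
    obtain ⟨v, hv⟩ := hw'
    have key : ∃ c : C, (Algebra.TensorProduct.map (Subalgebra.center F B).val
        (AlgHom.id F C)).toRingHom v = (1 : B) ⊗ₜ[F] c := by
      clear hv
      induction v using TensorProduct.induction_on with
      | zero => exact ⟨0, by simp⟩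
      | tmul b c =>
        obtain ⟨k, hk⟩ := Algebra.mem_bot.1 (Algebra.IsCentral.out b.2)
        refine ⟨k • c, ?_⟩
        rw [← TensorProduct.smul_tmul, ← Algebra.algebraMap_eq_smul_one, hk]
        rfl
      | add v₁ v₂ h₁ h₂ =>
        obtain ⟨c₁, h₁⟩ := h₁
        obtain ⟨c₂, h₂⟩ := h₂
        exact ⟨c₁ + c₂, by rw [map_add, h₁, h₂, TensorProduct.tmul_add]⟩
    obtain ⟨c, hc⟩ := key
    have hwc : w = (1 : B) ⊗ₜ[F] c := hv.symm.trans hc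
    have hc' : c ∈ Subalgebra.center F C := by
      refine Subalgebra.mem_center_iff.2 fun d => ?_
      have hd := Subalgebra.mem_center_iff.1 hw ((1 : B) ⊗ₜ[F] d)
      rw [hwc, Algebra.TensorProduct.tmul_mul_tmul, Algebra.TensorProduct.tmul_mul_tmul] at hd
      exact Algebra.TensorProduct.includeRight_injective (R := F) (A := B)
        (FaithfulSMul.algebraMap_injective F B) (by simpa using hd)
    obtain ⟨k, hk⟩ := Algebra.mem_bot.1 (Algebra.IsCentral.out hc')
    refine Algebra.mem_bot.2 ⟨k, ?_⟩
    rw [hwc, ← hk, Algebra.TensorProduct.algebraMap_apply, Algebra.algebraMap_eq_smul_one,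
      Algebra.algebraMap_eq_smul_one, TensorProduct.smul_tmul]

namespace IsBiquaternionAlgebra

variable {F A : Type*} [Field F] [Ring A] [Algebra F A]

theorem isCentral [CharP F 2] (hA : IsBiquaternionAlgebra F A) : Algebra.IsCentral F A := by
  obtain ⟨α, β, γ, δ, -, -, ⟨e⟩⟩ := hA
  have := QuaternionAlgebra.isCentral_of_charTwo α β
  have := QuaternionAlgebra.isCentral_of_charTwo γ δ
  have h := Algebra.IsCentral.tensorProduct (F := F) (B := ℍ[F, α, 1, β]) (C := ℍ[F, γ, 1, δ])
  refine ⟨fun a ha => ?_⟩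
  have ha' : e a ∈ Subalgebra.center F (ℍ[F, α, 1, β] ⊗[F] ℍ[F, γ, 1, δ]) := by
    refine Subalgebra.mem_center_iff.2 fun b => ?_
    obtain ⟨b, rfl⟩ := e.surjective b
    rw [← map_mul, ← map_mul, Subalgebra.mem_center_iff.1 ha b]
  obtain ⟨k, hk⟩ := Algebra.mem_bot.1 (h.out ha')
  exact Algebra.mem_bot.2 ⟨k, e.injective (by rw [e.commutes, hk])⟩

theorem finrank_eq (hA : IsBiquaternionAlgebra F A) : Module.finrank F A = 16 := by
  obtain ⟨α, β, γ, δ, -, -, ⟨e⟩⟩ := hA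
  rw [e.toLinearEquiv.finrank_eq, Module.finrank_tensorProduct,
    QuaternionAlgebra.finrank_eq_four, QuaternionAlgebra.finrank_eq_four]

end IsBiquaternionAlgebra

/-! ### Elements commuting with two pairs that share a member -/

theorem Algebra.two_eq_zero_of_charTwo (F A : Type*) [Field F] [CharP F 2] [Ring A] [Algebra F A] :
    (2 : A) = 0 := by
  rw [← map_ofNat (algebraMap F A) 2, CharTwo.two_eq_zero, map_zero]

section CommonElement

variable {F A : Type*} [Field F] [CharP F 2] [DivisionRing A] [Algebra F A]

/-- Two pairs `(x, y)` and `(x, y')` with the same Artin–Schreier element have a common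
non-scalar commuting element, provided that the first pair has one. -/
theorem exists_commute_of_common_artinSchreier {x y y' z : A} {β β' : F}
    (hy : y ^ 2 = algebraMap F A β) (hy' : y' ^ 2 = algebraMap F A β')
    (hy0 : y ≠ 0) (hxy : x * y + y * x = y) (hxy' : x * y' + y' * x = y')
    (hz : z ∉ (⊥ : Subalgebra F A)) (hzx : Commute z x) (hzy : Commute z y) :
    ∃ w ∉ (⊥ : Subalgebra F A), Commute w x ∧ Commute w y ∧ Commute w y' := by
  have h2 := Algebra.two_eq_zero_of_charTwo F A
  have hβy' := Algebra.commutes (A := A) β y'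
  have hβ'y := Algebra.commutes (A := A) β' y
  rw [← hy] at hβy'
  rw [← hy'] at hβ'y
  by_cases h₁ : y * y' + y' * y ∈ (⊥ : Subalgebra F A)
  · obtain ⟨l, hl⟩ := Algebra.mem_bot.1 h₁
    have hlx := Algebra.commutes l x
    have hly := Algebra.commutes l y
    have hly' := Algebra.commutes l y'
    by_cases h₂ : y' * y + algebraMap F A l * x ∈ (⊥ : Subalgebra F A)
    · obtain ⟨m, hm⟩ := Algebra.mem_bot.1 h₂
      refine ⟨z, hz, hzx, hzy, ?_⟩
      have h₃ : y' = (algebraMap F A m - algebraMap F A l * x) * y⁻¹ := by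
        rw [hm, add_sub_cancel_right, mul_assoc, mul_inv_cancel₀ hy0, mul_one]
      rw [h₃]
      exact (((Algebra.commute_algebraMap_right m z).sub_right
        (Commute.mul_right (Algebra.commute_algebraMap_right l z) hzx))).mul_right hzy.inv_right₀
    · generalize algebraMap F A l = l at *
      refine ⟨_, h₂, ?_, ?_, ?_⟩ <;> unfold Commute SemiconjBy
      · linear_combination (norm := noncomm_ring) y' * hxy - hxy' * y + hlx * x
      · linear_combination (norm := noncomm_ring) hl * y + l * hxy + hly * x
          + (y' * y * y - l * y * x) * h2
      · linear_combination (norm := noncomm_ring) y' * hl + l * hxy' + hly' * x + hly'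
          + (y' * y * y' - l * y' * x) * h2
  · refine ⟨_, h₁, ?_, ?_, ?_⟩ <;> unfold Commute SemiconjBy
    · linear_combination (norm := noncomm_ring) y' * hxy - hxy' * y + y * hxy' - hxy * y'
    · linear_combination (norm := noncomm_ring) -hβy'
    · linear_combination (norm := noncomm_ring) -hβ'y

/-- Two pairs `(x, y)` and `(x', y)` with the same square-central element have a common
non-scalar commuting element, provided that the first pair has one. -/
theorem exists_commute_of_common_squareCentral {x x' y z : A} {α α' : F}
    (hx : x ^ 2 + x = algebraMap F A α) (hx' : x' ^ 2 + x' = algebraMap F A α')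
    (hy0 : y ≠ 0) (hxy : x * y + y * x = y) (hxy' : x' * y + y * x' = y)
    (hz : z ∉ (⊥ : Subalgebra F A)) (hzx : Commute z x) (hzy : Commute z y) :
    ∃ w ∉ (⊥ : Subalgebra F A), Commute w x ∧ Commute w y ∧ Commute w x' := by
  have h2 := Algebra.two_eq_zero_of_charTwo F A
  have hαx' := Algebra.commutes (A := A) α x'
  have hα'x := Algebra.commutes (A := A) α' x
  rw [← hx] at hαx'
  rw [← hx'] at hα'x
  -- `x * x' + x' * x` commutes with `y`, and the inner derivations by `x` and `x'` fix it.
  by_cases h₁ : y * (x * x' + x' * x) ∈ (⊥ : Subalgebra F A)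
  · by_cases h₂ : x + x' + (x * x' + x' * x) ∈ (⊥ : Subalgebra F A)
    · obtain ⟨l, hl⟩ := Algebra.mem_bot.1 h₁
      obtain ⟨m, hm⟩ := Algebra.mem_bot.1 h₂
      refine ⟨z, hz, hzx, hzy, ?_⟩
      have h₃ : x' = algebraMap F A m - y⁻¹ * algebraMap F A l - x := by
        rw [hm, hl, inv_mul_cancel_left₀ hy0]
        abel
      rw [h₃]
      exact ((Algebra.commute_algebraMap_right m z).sub_right
        (hzy.inv_right₀.mul_right (Algebra.commute_algebraMap_right l z))).sub_right hzx
    · refine ⟨_, h₂, ?_, ?_, ?_⟩ <;> unfold Commute SemiconjBy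
      · linear_combination (norm := noncomm_ring) hαx' +
          (x' * x + x' * x * x - x * x' - x * x * x') * h2
      · linear_combination (norm := noncomm_ring) x * hxy' - hxy * x' + x' * hxy - hxy' * x
          + 2 * hxy + 2 * hxy' + 2 * (y - y * x - y * x') * h2
      · linear_combination (norm := noncomm_ring) hα'x +
          (x * x' + x * x' * x' - x' * x - x' * x' * x) * h2
  · refine ⟨_, h₁, ?_, ?_, ?_⟩ <;> unfold Commute SemiconjBy
    · linear_combination (norm := noncomm_ring) -hxy * (x * x' + x' * x) + y * hαx'
        + y * (x * x' * x + x' * x * x - x * x') * h2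
    · linear_combination (norm := noncomm_ring) y * (x * hxy' - hxy * x' + x' * hxy - hxy' * x
        + hxy + hxy'
        + (y - y * x - y * x') * h2)
    · linear_combination (norm := noncomm_ring) -hxy' * (x * x' + x' * x) + y * hα'x
        + y * (x' * x * x' + x * x' * x' - x' * x) * h2

end CommonElement

/-! ### The centralizer of a pair -/

namespace GenQuadruple

section Central

variable {F A : Type*} [Field F] [DivisionRing A] [Algebra F A]
  [Algebra.IsCentral F A]
  (q : GenQuadruple F A)

theorem exists_algebraMap_of_commute {c : A} (hx : Commute c q.x) (hy : Commute c q.y)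
    (hz : Commute c q.z) (hu : Commute c q.u) : ∃ k : F, algebraMap F A k = c := by
  refine Algebra.mem_bot.1 (Algebra.IsCentral.out (Subalgebra.mem_center_iff.2 fun b => ?_))
  have hle : Algebra.adjoin F {q.x, q.y, q.z, q.u} ≤ Subalgebra.centralizer F {c} := by
    have h : ∀ a, Commute c a → a ∈ Subalgebra.centralizer F {c} := fun a ha =>
      (Subalgebra.mem_centralizer_iff F).2 (by rintro _ rfl; exact ha)
    refine Algebra.adjoin_le ?_
    rintro a (rfl | rfl | rfl | rfl)
    exacts [h _ hx, h _ hy, h _ hz, h _ hu]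
  rw [q.generate] at hle
  exact (Subalgebra.mem_centralizer_iff F |>.1 (hle Algebra.mem_top) c rfl).symm

variable [CharP F 2]

/-- The centralizer of `x, y` is spanned over `F` by `1, z, u, u z`. -/
theorem exists_eq_of_commute {w : A} (hu0 : q.u ≠ 0) (hx : Commute w q.x) (hy : Commute w q.y) :
    ∃ a b c d : F, w = algebraMap F A a + algebraMap F A b * q.z
      + q.u * (algebraMap F A c + algebraMap F A d * q.z) := by
  have h2 := Algebra.two_eq_zero_of_charTwo F A
  obtain ⟨γ, hγ⟩ := q.z_artinSchreier
  obtain ⟨δ, hδ⟩ := q.u_squareCentral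
  have hzu := q.zu_rel
  have hzx : Commute q.z q.x := q.xz_comm.symm
  have hzy : Commute q.z q.y := q.yz_comm.symm
  have hux : Commute q.u q.x := q.xu_comm.symm
  have huy : Commute q.u q.y := q.yu_comm.symm
  have hut : q.u * q.u⁻¹ = 1 := mul_inv_cancel₀ hu0
  have htu : q.u⁻¹ * q.u = 1 := inv_mul_cancel₀ hu0
  have htz : q.u⁻¹ * q.z = q.z * q.u⁻¹ + q.u⁻¹ := by
    linear_combination (norm := noncomm_ring) q.u⁻¹ * hzu * q.u⁻¹ - q.u⁻¹ * q.z * hut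
      - htu * q.z * q.u⁻¹ + htu * q.u⁻¹ - q.z * q.u⁻¹ * h2
  -- `C(x, y, z) = F + F z`: conjugation by `u` is an involution of it that fixes only `F` and maps
  -- `z` to `z + 1`, so `e` is a scalar plus `f * z`, where `f` is its trace under the involution.
  have key : ∀ e : A, Commute e q.x → Commute e q.y → Commute e q.z →
      ∃ a b : F, e = algebraMap F A a + algebraMap F A b * q.z := by
    intro e hex hey hez
    have hδe := Algebra.commutes δ e
    rw [← hδ] at hδe
    set f := e + q.u * e * q.u⁻¹ with hf
    have hfx : Commute f q.x := hex.add_left ((hux.mul_left hex).mul_left hux.inv_left₀)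
    have hfy : Commute f q.y := hey.add_left ((huy.mul_left hey).mul_left huy.inv_left₀)
    have hfz : Commute f q.z := by
      rw [hf]
      unfold Commute SemiconjBy
      linear_combination (norm := noncomm_ring) hez.eq + q.u * e * htz + q.u * hez.eq * q.u⁻¹
        - hzu * e * q.u⁻¹ + q.u * q.z * e * q.u⁻¹ * h2
    have hfu : Commute f q.u := by
      rw [hf]
      unfold Commute SemiconjBy
      linear_combination (norm := noncomm_ring) q.u * e * htu - hδe * q.u⁻¹ - e * q.u * hut
    obtain ⟨b, hb⟩ := q.exists_algebraMap_of_commute hfx hfy hfz hfu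
    have hgu : Commute (e - f * q.z) q.u := by
      unfold Commute SemiconjBy
      linear_combination (norm := noncomm_ring) -f * hzu - hfu.eq * q.z - hf * q.u
        - q.u * e * htu + (f * q.u * q.z - q.u * e) * h2
    obtain ⟨a, ha⟩ := q.exists_algebraMap_of_commute (hex.sub_left (hfx.mul_left hzx))
      (hey.sub_left (hfy.mul_left hzy)) (hez.sub_left (hfz.mul_left (.refl _))) hgu
    exact ⟨a, b, by rw [ha, hb, sub_add_cancel]⟩
  -- The inner derivation by `z` is a projection `w ↦ v` on `C(x, y)`, with kernel `C(x, y, z)` and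
  -- image `u C(x, y, z)`.
  have hγw := Algebra.commutes γ w
  rw [← hγ] at hγw
  set v := q.z * w + w * q.z with hv
  have hvx : Commute v q.x := (hzx.mul_left hx).add_left (hx.mul_left hzx)
  have hvy : Commute v q.y := (hzy.mul_left hy).add_left (hy.mul_left hzy)
  have hvz : q.z * v + v * q.z = v := by
    rw [hv]
    linear_combination (norm := noncomm_ring) hγw + (q.z * w * q.z + w * q.z ^2 - q.z * w) * h2
  obtain ⟨a, b, hab⟩ := key (w + v) (hx.add_left hvx) (hy.add_left hvy) (by
    unfold Commute SemiconjBy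
    linear_combination (norm := noncomm_ring) -hvz - hv + (v * q.z - q.z * w) * h2)
  obtain ⟨c, d, hcd⟩ := key (q.u⁻¹ * v) (hux.inv_left₀.mul_left hvx) (huy.inv_left₀.mul_left hvy)
    (by
      unfold Commute SemiconjBy
      linear_combination (norm := noncomm_ring) q.u⁻¹ * hvz + htz * v
        + (q.u⁻¹ * v - q.u⁻¹ * q.z * v) * h2)
  refine ⟨a, b, c, d, ?_⟩
  rw [← hab, ← hcd, mul_inv_cancel_left₀ hu0]
  linear_combination (norm := noncomm_ring) -v * h2

/-- Every element `w` of the quaternion algebra `C(x, y)` satisfies a quadratic equation; `k` is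
its reduced trace and `l` its reduced norm. -/
theorem exists_sq_add_mul_eq {w : A} (hu0 : q.u ≠ 0) (hx : Commute w q.x) (hy : Commute w q.y) :
    ∃ k l : F, w ^ 2 + algebraMap F A k * w = algebraMap F A l := by
  have h2 := Algebra.two_eq_zero_of_charTwo F A
  have h2F : (2 : F) = 0 := CharTwo.two_eq_zero
  obtain ⟨γ, hγ⟩ := q.z_artinSchreier
  obtain ⟨δ, hδ⟩ := q.u_squareCentral
  have hzu := q.zu_rel
  obtain ⟨a, b, c, d, rfl⟩ := q.exists_eq_of_commute hu0 hx hy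
  refine ⟨b, a ^ 2 + a * b + b ^ 2 * γ + δ * (c ^ 2 + c * d + d ^ 2 * γ), ?_⟩
  -- The multiplication table on `1, z, u, u z`.
  have huu : q.u * q.u = δ • (1 : A) := by rw [← sq, hδ, Algebra.algebraMap_eq_smul_one]
  have hzz : q.z * q.z = γ • (1 : A) + q.z := by
    rw [← Algebra.algebraMap_eq_smul_one, ← hγ]
    linear_combination (norm := noncomm_ring) -q.z * h2
  have hzu' : q.z * q.u = q.u * q.z + q.u := by
    linear_combination (norm := noncomm_ring) hzu - q.u * q.z * h2
  have huu' : ∀ t, q.u * (q.u * t) = δ • t := fun t => by rw [← mul_assoc, huu, smul_one_mul]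
  have hzu'' : ∀ t, q.z * (q.u * t) = q.u * (q.z * t) + q.u * t := fun t => by
    rw [← mul_assoc, hzu', add_mul, mul_assoc]
  simp only [Algebra.algebraMap_eq_smul_one, sq, add_mul, mul_add, smul_mul_assoc, mul_smul_comm,
    one_mul, mul_one, mul_assoc, huu, hzz, hzu', huu', hzu'']
  match_scalars
  · ring
  · linear_combination (a * b + b ^ 2 + c * d * δ + d ^ 2 * δ) * h2F
  · linear_combination (a * c + b * d * γ + b * c) * h2F
  · linear_combination (a * d + b * c + 2 * b * d) * h2F

end Central

end GenQuadruple

/-! ### Changing the second pair -/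

namespace GenQuadruple

section Pairs

variable {F A : Type*} [Field F] [CharP F 2] [DivisionRing A] [Algebra F A]

theorem notMem_bot_of_rel {w t : A} (hwt : w * t + t * w = t) (ht : t ≠ 0) :
    w ∉ (⊥ : Subalgebra F A) := by
  intro hw
  obtain ⟨k, rfl⟩ := Algebra.mem_bot.1 hw
  rw [Algebra.commutes, ← mul_two, Algebra.two_eq_zero_of_charTwo F A, mul_zero] at hwt
  exact ht hwt.symm

theorem linearIndependent_of_rel {w t : A} (hwt : w * t + t * w = t) (ht : t ≠ 0) :
    LinearIndependent F ![1, w, t, t * w] := by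
  have h2 := Algebra.two_eq_zero_of_charTwo F A
  have hw : w ∉ (⊥ : Subalgebra F A) := notMem_bot_of_rel hwt ht
  -- `1` and `w` are linearly independent.
  have key : ∀ a b : F, algebraMap F A a + algebraMap F A b * w = 0 → a = 0 ∧ b = 0 := by
    intro a b hab
    have hb : b = 0 := by
      by_contra hb
      refine hw (Algebra.mem_bot.2 ⟨-(b⁻¹ * a), ?_⟩)
      rw [map_neg, map_mul, eq_neg_of_add_eq_zero_left hab, mul_neg, neg_neg, ← mul_assoc,
        ← map_mul, inv_mul_cancel₀ hb, map_one, one_mul]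
    refine ⟨?_, hb⟩
    rw [hb, map_zero, zero_mul, add_zero] at hab
    exact (map_eq_zero_iff _ (FaithfulSMul.algebraMap_injective F A)).1 hab
  rw [Fintype.linearIndependent_iff]
  intro g hg
  set e := algebraMap F A (g 0) + algebraMap F A (g 1) * w with he
  set f := algebraMap F A (g 2) + algebraMap F A (g 3) * w with hf
  have hef : e + t * f = 0 := by
    rw [← hg]
    simp [Fin.sum_univ_four, he, hf, Algebra.algebraMap_eq_smul_one, mul_add, add_assoc]
  have hew : e * w = w * e :=
    (((Algebra.commute_algebraMap_left _ w).add_left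
      ((Algebra.commute_algebraMap_left _ w).mul_left (.refl w))))
  have hfw : f * w = w * f :=
    (((Algebra.commute_algebraMap_left _ w).add_left
      ((Algebra.commute_algebraMap_left _ w).mul_left (.refl w))))
  -- Taking the commutator with `w` kills `e` and fixes `t * f`.
  have htf : t * f = 0 := by
    linear_combination (norm := noncomm_ring) w * hef - hef * w - hwt * f + hew + t * hfw
      + t * w * f * h2
  have hf0 := (mul_eq_zero.1 htf).resolve_left ht
  rw [htf, add_zero] at hef
  obtain ⟨h0, h1⟩ := key _ _ hef
  obtain ⟨h2, h3⟩ := key _ _ hf0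
  intro i
  fin_cases i <;> assumption

variable [Algebra.IsCentral F A] (q : GenQuadruple F A)

theorem mem_span_of_commute {w : A} (hu0 : q.u ≠ 0) (hx : Commute w q.x) (hy : Commute w q.y) :
    w ∈ Submodule.span F (Set.range ![1, q.z, q.u, q.u * q.z]) := by
  obtain ⟨a, b, c, d, rfl⟩ := q.exists_eq_of_commute hu0 hx hy
  refine (Submodule.mem_span_range_iff_exists_fun F).2 ⟨![a, b, c, d], ?_⟩
  simp [Fin.sum_univ_four, Algebra.algebraMap_eq_smul_one, mul_add, add_assoc]

/-- If `u = 0`, then `z` is central, so that `A` is spanned by `1, x, y, y x`. -/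
theorem u_ne_zero (hdim : 4 < Module.finrank F A) : q.u ≠ 0 := by
  intro hu
  have hcz : ∀ {k : F}, algebraMap F A k = q.z → ∀ c, Commute c q.z := fun hk c =>
    hk ▸ Algebra.commute_algebraMap_right _ c
  obtain ⟨k, hk⟩ := q.exists_algebraMap_of_commute q.xz_comm.symm q.yz_comm.symm
    (.refl q.z) (hu ▸ .zero_right _)
  by_cases hy : q.y = 0
  · obtain ⟨l, hl⟩ := q.exists_algebraMap_of_commute (.refl q.x) (hy ▸ .zero_right _)
      q.xz_comm q.xu_comm
    have hle : Algebra.adjoin F {q.x, q.y, q.z, q.u} ≤ (⊥ : Subalgebra F A) := by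
      refine Algebra.adjoin_le ?_
      rintro a (rfl | rfl | rfl | rfl)
      exacts [Algebra.mem_bot.2 ⟨l, hl⟩, hy ▸ zero_mem _, Algebra.mem_bot.2 ⟨k, hk⟩,
        hu ▸ zero_mem _]
    rw [q.generate, top_le_iff] at hle
    have := Subalgebra.bot_eq_top_iff_finrank_eq_one.1 hle
    omega
  · have htop : (⊤ : Submodule F A) ≤ Submodule.span F (Set.range ![1, q.x, q.y, q.y * q.x]) :=
      fun w _ => q.swap.mem_span_of_commute hy (hcz hk w)
        (show Commute w q.u from hu ▸ .zero_right _)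
    have h := finrank_range_le_card (R := F) ![1, q.x, q.y, q.y * q.x]
    rw [Set.finrank, top_le_iff.1 htop, finrank_top, Fintype.card_fin] at h
    omega

theorem y_ne_zero (hdim : 4 < Module.finrank F A) : q.y ≠ 0 :=
  q.swap.u_ne_zero hdim

/-- Any `w, t` in `C(x, y)` with `w t + t w = t ≠ 0` form a pair that can replace `(z, u)`: the
relation forces the reduced traces of `w` and `t` to be `1` and `0`, and the four elements
`1, w, t, t w` span `C(x, y)` by dimension. -/
theorem exists_replace_zu {w t : A} (hu0 : q.u ≠ 0) (hwx : Commute w q.x) (hwy : Commute w q.y)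
    (htx : Commute t q.x) (hty : Commute t q.y) (hwt : w * t + t * w = t) (ht : t ≠ 0) :
    ∃ s : GenQuadruple F A, s.x = q.x ∧ s.y = q.y ∧ s.z = w ∧ s.u = t := by
  have h2 := Algebra.two_eq_zero_of_charTwo F A
  have hspan : Submodule.span F (Set.range ![1, w, t, t * w])
      = Submodule.span F (Set.range ![1, q.z, q.u, q.u * q.z]) := by
    have := FiniteDimensional.span_of_finite F (Set.finite_range ![1, q.z, q.u, q.u * q.z])
    refine Submodule.eq_of_le_of_finrank_le ?_ ?_
    · rw [Submodule.span_le]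
      rintro _ ⟨i, rfl⟩
      fin_cases i
      exacts [q.mem_span_of_commute hu0 (.one_left _) (.one_left _),
        q.mem_span_of_commute hu0 hwx hwy, q.mem_span_of_commute hu0 htx hty,
        q.mem_span_of_commute hu0 (htx.mul_left hwx) (hty.mul_left hwy)]
    · rw [finrank_span_eq_card (linearIndependent_of_rel hwt ht)]
      exact finrank_range_le_card _
  have hle : Submodule.span F (Set.range ![1, w, t, t * w])
      ≤ Subalgebra.toSubmodule (Algebra.adjoin F {q.x, q.y, w, t}) := by
    have hw : w ∈ Algebra.adjoin F {q.x, q.y, w, t} := Algebra.subset_adjoin (by simp)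
    have ht : t ∈ Algebra.adjoin F {q.x, q.y, w, t} := Algebra.subset_adjoin (by simp)
    rw [Submodule.span_le]
    rintro _ ⟨i, rfl⟩
    fin_cases i
    exacts [Subalgebra.one_mem _, hw, ht, Subalgebra.mul_mem _ ht hw]
  obtain ⟨k, l, hkl⟩ := q.exists_sq_add_mul_eq hu0 hwx hwy
  obtain ⟨m, n, hmn⟩ := q.exists_sq_add_mul_eq hu0 htx hty
  have hlt := Algebra.commutes l t
  have hkt := Algebra.commutes k t
  have hnw := Algebra.commutes n w
  have hmw := Algebra.commutes m w
  rw [← hkl] at hlt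
  rw [← hmn] at hnw
  -- Commuting the quadratic equations of `w` and `t` with `t` and `w` determines both traces.
  have hk : algebraMap F A k = 1 := by
    refine mul_right_cancel₀ ht ?_
    linear_combination (norm := noncomm_ring) hlt - w * hwt + hwt * w - hwt
      - algebraMap F A k * hwt - hkt * w + (t * w + algebraMap F A k * t * w - t) * h2
  have hm : algebraMap F A m = 0 := by
    refine (mul_eq_zero.1 (?_ : algebraMap F A m * t = 0)).resolve_right ht
    linear_combination (norm := noncomm_ring) hnw - t * hwt + hwt * t
      - algebraMap F A m * hwt - hmw * t + algebraMap F A m * w * t * h2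
  refine ⟨⟨q.x, q.y, w, t, q.x_artinSchreier, q.y_squareCentral, ⟨l, by rw [← hkl, hk, one_mul]⟩,
    ⟨n, by rw [← hmn, hm, zero_mul, add_zero]⟩, q.xy_rel, hwx.symm, htx.symm, hwy.symm, hty.symm,
    hwt, ?_⟩, rfl, rfl, rfl, rfl⟩
  rw [eq_top_iff, ← q.generate]
  refine Algebra.adjoin_le ?_
  rintro a (rfl | rfl | rfl | rfl)
  · exact Algebra.subset_adjoin (by simp)
  · exact Algebra.subset_adjoin (by simp)
  · exact hle (hspan ▸ q.mem_span_of_commute hu0 q.xz_comm.symm q.yz_comm.symm)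
  · exact hle (hspan ▸ q.mem_span_of_commute hu0 q.xu_comm.symm q.yu_comm.symm)

theorem exists_not_commute {w : A} (hw : w ∉ (⊥ : Subalgebra F A)) (hx : Commute w q.x)
    (hy : Commute w q.y) : ∃ v, Commute v q.x ∧ Commute v q.y ∧ w * v + v * w ≠ 0 := by
  by_contra! h
  have h' : ∀ v, Commute v q.x → Commute v q.y → Commute w v := fun v hvx hvy => by
    have h2 := Algebra.two_eq_zero_of_charTwo F A
    unfold Commute SemiconjBy
    linear_combination (norm := noncomm_ring) h v hvx hvy - v * w * h2
  exact hw (Algebra.mem_bot.2 (q.exists_algebraMap_of_commute hx hy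
    (h' _ q.xz_comm.symm q.yz_comm.symm) (h' _ q.xu_comm.symm q.yu_comm.symm)))

/-- An Artin–Schreier element `w` of `C(x, y)` outside `F` can replace `z`. Its partner is a
nonzero value of the inner derivation by `w`, which is idempotent. -/
theorem exists_replace_z {w : A} (hu0 : q.u ≠ 0) (hw : w ∉ (⊥ : Subalgebra F A))
    (hx : Commute w q.x) (hy : Commute w q.y) {l : F} (hl : w ^ 2 + w = algebraMap F A l) :
    ∃ s : GenQuadruple F A, s.x = q.x ∧ s.y = q.y ∧ s.z = w := by
  have h2 := Algebra.two_eq_zero_of_charTwo F A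
  obtain ⟨v, hvx, hvy, hv⟩ := q.exists_not_commute hw hx hy
  have hlv := Algebra.commutes l v
  rw [← hl] at hlv
  obtain ⟨s, hsx, hsy, hsz, -⟩ := q.exists_replace_zu (w := w) (t := w * v + v * w) hu0 hx hy
    ((hx.mul_left hvx).add_left (hvx.mul_left hx)) ((hy.mul_left hvy).add_left (hvy.mul_left hy))
    (by linear_combination (norm := noncomm_ring) hlv
          + (w * v * w + v * w ^ 2 - w * v) * h2) hv
  exact ⟨s, hsx, hsy, hsz⟩

/-- A square-central element `w` of `C(x, y)` outside `F` can replace `u`. If the inner derivation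
by `w`, whose square is zero, has a nonzero value `d` at `v`, the partner is `w d⁻¹ v`. -/
theorem exists_replace_u {w : A} (hu0 : q.u ≠ 0) (hw : w ∉ (⊥ : Subalgebra F A))
    (hx : Commute w q.x) (hy : Commute w q.y) {l : F} (hl : w ^ 2 = algebraMap F A l) :
    ∃ s : GenQuadruple F A, s.x = q.x ∧ s.y = q.y ∧ s.u = w := by
  have h2 := Algebra.two_eq_zero_of_charTwo F A
  obtain ⟨v, hvx, hvy, hv⟩ := q.exists_not_commute hw hx hy
  have hlv := Algebra.commutes l v
  rw [← hl] at hlv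
  set d := w * v + v * w with hd
  have hdx : Commute d q.x := (hx.mul_left hvx).add_left (hvx.mul_left hx)
  have hdy : Commute d q.y := (hy.mul_left hvy).add_left (hvy.mul_left hy)
  have hwd : Commute w d := by
    rw [hd]
    unfold Commute SemiconjBy
    linear_combination (norm := noncomm_ring) hlv
  have hwd' := hwd.inv_right₀.eq
  have hdd : d⁻¹ * d = 1 := inv_mul_cancel₀ hv
  obtain ⟨s, hsx, hsy, -, hsu⟩ := q.exists_replace_zu (w := w * d⁻¹ * v) (t := w) hu0
    ((hx.mul_left hdx.inv_left₀).mul_left hvx) ((hy.mul_left hdy.inv_left₀).mul_left hvy) hx hy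
    (by linear_combination (norm := noncomm_ring) w * hwd' * v - w * d⁻¹ * hd + w * hdd)
    (by rintro rfl; exact hw (zero_mem _))
  exact ⟨s, hsx, hsy, hsu⟩

end Pairs

/-! ### Chains -/

section Swap

variable {F A : Type*} [Field F] [Ring A] [Algebra F A] {q r s : GenQuadruple F A}

theorem Same.swap_right (h : q.Same r) : q.Same r.swap := by
  rcases h with rfl | rfl
  exacts [.inr rfl, .inl rfl]

theorem StepPi.of_swap (h : q.swap.StepPi r) : q.StepPi r := by
  obtain ⟨s, hs, h⟩ := h
  exact ⟨s.swap, hs.swap_right, h.symm⟩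

end Swap

section Chain

variable {F A : Type*} [Field F] [CharP F 2] [DivisionRing A] [Algebra F A]
  [Algebra.IsCentral F A]

/-- A non-scalar element that commutes with the first pairs of `q` and `s` can be made a member
of the second pair of both. -/
theorem exists_steps_of_common_commute {q s : GenQuadruple F A} (hdim : 4 < Module.finrank F A)
    (hxy : q.x = s.x ∨ q.y = s.y) {w : A} (hw : w ∉ (⊥ : Subalgebra F A))
    (hqx : Commute w q.x) (hqy : Commute w q.y) (hsx : Commute w s.x) (hsy : Commute w s.y) :
    ∃ q' s' : GenQuadruple F A, q.StepPi q' ∧ q'.StepLambda2 s' ∧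
      s'.x = s.x ∧ s'.y = s.y := by
  have hqu := q.u_ne_zero hdim
  have hsu := s.u_ne_zero hdim
  obtain ⟨k, l, hkl⟩ := q.exists_sq_add_mul_eq hqu hqx hqy
  by_cases hk : k = 0
  -- The quadratic equation involves `w` only, so `w` plays the same role for `q` and for `s`.
  · rw [hk, map_zero, zero_mul, add_zero] at hkl
    obtain ⟨q', hq'x, hq'y, hq'⟩ := q.exists_replace_u hqu hw hqx hqy hkl
    obtain ⟨s', hs'x, hs'y, hs'⟩ := s.exists_replace_u hsu hw hsx hsy hkl
    exact ⟨q', s', ⟨q', .inl rfl, .inl ⟨hq'x.symm, hq'y.symm⟩⟩,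
      ⟨s', .inl rfl, by rwa [hq'x, hq'y, hs'x, hs'y], .inr (hq'.trans hs'.symm)⟩, hs'x, hs'y⟩
  · have hw' : k⁻¹ • w ∉ (⊥ : Subalgebra F A) := fun h => hw (by
      simpa [smul_smul, hk] using Subalgebra.smul_mem _ h k)
    have hl : (k⁻¹ • w) ^ 2 + k⁻¹ • w = algebraMap F A (k⁻¹ ^ 2 * l) := by
      rw [map_mul, ← hkl, ← Algebra.smul_def, ← Algebra.smul_def, smul_pow, smul_add, smul_smul]
      congr 2
      field_simp
    obtain ⟨q', hq'x, hq'y, hq'⟩ := q.exists_replace_z hqu hw' (hqx.smul_left _)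
      (hqy.smul_left _) hl
    obtain ⟨s', hs'x, hs'y, hs'⟩ := s.exists_replace_z hsu hw' (hsx.smul_left _)
      (hsy.smul_left _) hl
    exact ⟨q', s', ⟨q', .inl rfl, .inl ⟨hq'x.symm, hq'y.symm⟩⟩,
      ⟨s', .inl rfl, by rwa [hq'x, hq'y, hs'x, hs'y], .inl (hq'.trans hs'.symm)⟩, hs'x, hs'y⟩

theorem exists_steps_of_common {q s : GenQuadruple F A} (hdim : 4 < Module.finrank F A)
    (hxy : q.x = s.x ∨ q.y = s.y) :
    ∃ q' s' : GenQuadruple F A, q.StepPi q' ∧ q'.StepLambda2 s' ∧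
      s'.x = s.x ∧ s'.y = s.y := by
  have hy0 := q.y_ne_zero hdim
  have hz : q.z ∉ (⊥ : Subalgebra F A) := notMem_bot_of_rel q.zu_rel (q.u_ne_zero hdim)
  obtain ⟨w, hw, hqx, hqy, hsx, hsy⟩ : ∃ w ∉ (⊥ : Subalgebra F A),
      Commute w q.x ∧ Commute w q.y ∧ Commute w s.x ∧ Commute w s.y := by
    rcases hxy with h | h
    · obtain ⟨β, hβ⟩ := q.y_squareCentral
      obtain ⟨β', hβ'⟩ := s.y_squareCentral
      obtain ⟨w, hw, h₁, h₂, h₃⟩ := exists_commute_of_common_artinSchreier hβ hβ' hy0 q.xy_rel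
        (by rw [h]; exact s.xy_rel) hz q.xz_comm.symm q.yz_comm.symm
      exact ⟨w, hw, h₁, h₂, h ▸ h₁, h₃⟩
    · obtain ⟨α, hα⟩ := q.x_artinSchreier
      obtain ⟨α', hα'⟩ := s.x_artinSchreier
      obtain ⟨w, hw, h₁, h₂, h₃⟩ := exists_commute_of_common_squareCentral hα hα' hy0 q.xy_rel
        (by rw [h]; exact s.xy_rel) hz q.xz_comm.symm q.yz_comm.symm
      exact ⟨w, hw, h₁, h₂, h₃, h ▸ h₂⟩
  exact exists_steps_of_common_commute hdim hxy hw hqx hqy hsx hsy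

end Chain

end GenQuadruple

theorem mainTheorem2 {F A : Type*} [Field F] [CharP F 2] [DivisionRing A] [Algebra F A]
    (hA : IsBiquaternionAlgebra F A) (q r : GenQuadruple F A) (h : q.StepLambda3 r) :
    ∃ m n : ℕ, m ≤ 3 ∧ n ≤ 2 ∧ GenQuadruple.Chain m n q r := by
  have := hA.isCentral
  have hdim : 4 < Module.finrank F A := by rw [hA.finrank_eq]; norm_num
  obtain ⟨s, hrs, h⟩ := h
  -- Two steps of type `Π` and one of type `Λ₂` always suffice.
  refine ⟨2, 1, by norm_num, by norm_num, ?_⟩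
  obtain ⟨q', s', hq, hm, hs⟩ : ∃ q' s' : GenQuadruple F A,
      q.StepPi q' ∧ q'.StepLambda2 s' ∧ s'.StepPi r := by
    have h' : (q.x = s.x ∨ q.y = s.y) ∨ (q.z = s.z ∨ q.u = s.u) := by tauto
    rcases h' with h | h
    · obtain ⟨q', s', hq, hm, hs⟩ := GenQuadruple.exists_steps_of_common hdim h
      exact ⟨q', s', hq, hm, s, hrs, .inl hs⟩
    · obtain ⟨q', s', hq, hm, hs⟩ :=
        GenQuadruple.exists_steps_of_common (q := q.swap) (s := s.swap) hdim h
      exact ⟨q', s', hq.of_swap, hm, s.swap, hrs.swap_right, .inl hs⟩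
  exact .consPi hq (.consLambda2 hm (.consPi hs (.nil (.inl rfl))))
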